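/- Let $F$ be a finite field of odd characteristic with $q$ elements and let $n\ge 1$. For a symmetric nonsingular bilinear form $f$ on an $n$-dimensional $F$-vector space $V$, let $O(V,f)$ be the group of linear maps $g\colon V\to V$ with $f(g(u),g(v))=f(u,v)$ for all $u,v\in V$. A subspace $W\subseteq V$ is totally isotropic for $f$ if $f(u,w)=0$ for all $u,w\in W$. (1) If $n$ is odd, there is, up to group isomorphism, exactly one group $O(V,f)$, denoted $O(n)$: such forms $f$ exist, and the groups $O(V,f)$ and $O(V',f')$ are isomorphic for all symmetric nonsingular bilinear forms $f,f'$ on $n$-dimensional spaces $V,V'$. (2) If $n=2m$ is even, with $m\ge 1$, there are, up to group isomorphism, exactly two groups $O(V,f)$, denoted $O^+(n)$ and $O^-(n)$. One has $O(V,f)\cong O^+(n)$ if $V$ has a totally isotropic subspace of dimension $m=n/2$ for $f$, and $O(V,f)\cong O^-(n)$ otherwise; both cases occur on every $n$-dimensional space $V$, and $O^+(n)\not\cong O^-(n)$. Their orders are $$|O^{+}(n)| = 2\,(q^m-1)\,q^{m(m-1)}\prod_{i=1}^{m-1}\left(q^{2m-2i}-1\right),\qquad |O^{-}(n)| = 2\,(q^m+1)\,q^{m(m-1)}\prod_{i=1}^{m-1}\left(q^{2m-2i}-1\right).$$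 -/

import Mathlib

/-- The orthogonal group `O(V, f)`: the invertible linear maps `g : V → V` with
`f (g u) (g v) = f u v` for all `u, v`. (For `f` nonsingular and `V` finite dimensional,
invertibility is automatic, see `mem_orthogonalGroupOf_of_linear` below.) -/
def orthogonalGroupOf {F V : Type*} [Field F] [AddCommGroup V] [Module F V]
    (f : LinearMap.BilinForm F V) : Subgroup (V ≃ₗ[F] V) where
  carrier := {g | ∀ u v : V, f (g u) (g v) = f u v}
  one_mem' := fun _ _ => rfl
  mul_mem' := by
    intro a b ha hb u v
    simp only [LinearEquiv.mul_apply]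
    rw [ha, hb]
  inv_mem' := by
    intro a ha u v
    have h := ha (a⁻¹ u) (a⁻¹ v)
    rw [← LinearEquiv.mul_apply, ← LinearEquiv.mul_apply, mul_inv_cancel] at h
    exact h.symm

/-- Every linear map preserving a nonsingular form on a finite-dimensional space is (the map
underlying) an element of the orthogonal group. -/
theorem mem_orthogonalGroupOf_of_linear {F V : Type*} [Field F] [AddCommGroup V] [Module F V]
    [FiniteDimensional F V] (f : LinearMap.BilinForm F V) (hf : f.Nondegenerate)
    (g : V →ₗ[F] V) (hg : ∀ u v : V, f (g u) (g v) = f u v) :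
    ∃ e ∈ orthogonalGroupOf f, ∀ v : V, e v = g v := by
  have hinj : Function.Injective g := by
    rw [injective_iff_map_eq_zero]
    intro u hu
    apply hf.1 u
    intro v
    rw [← hg u v, hu, map_zero, LinearMap.zero_apply]
  exact ⟨LinearEquiv.ofInjectiveEndo g hinj, fun u v => hg u v, fun v => rfl⟩

/-- A subspace `W` is totally isotropic for `f` if `f u w = 0` for all `u, w ∈ W`. -/
def IsTotallyIsotropic {F V : Type*} [Field F] [AddCommGroup V] [Module F V]
    (f : LinearMap.BilinForm F V) (W : Submodule F V) : Prop :=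
  ∀ u ∈ W, ∀ w ∈ W, f u w = 0

/-- `f` admits a totally isotropic subspace of dimension `m`. -/
def HasTotallyIsotropic {F V : Type*} [Field F] [AddCommGroup V] [Module F V]
    (f : LinearMap.BilinForm F V) (m : ℕ) : Prop :=
  ∃ W : Submodule F V, Module.finrank F W = m ∧ IsTotallyIsotropic f W

/-- Symmetric nonsingular bilinear forms. -/
def IsOrthogonalForm {F V : Type*} [Field F] [AddCommGroup V] [Module F V]
    (f : LinearMap.BilinForm F V) : Prop :=
  f.IsSymm ∧ f.Nondegenerate

-- Over a finite field of odd characteristic a nonsingular symmetric form is determined by its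
-- dimension and its discriminant modulo squares (`formEquiv_of_isSquare`): in dimension at least 2
-- every value is taken, so a vector of value 1 splits off and induction applies to its complement.
-- There are thus two classes of forms in each positive dimension.
--
-- Scaling a form by `c` keeps its group and multiplies the discriminant by `c ^ n`. For odd `n`
-- this exchanges the two classes, which leaves one group. For `n = 2m` the classes are told apart
-- by whether `(-1)^m` times the discriminant is a square, which is the condition for a totally
-- isotropic `m`-space (`hasTotallyIsotropic_iff`).
--
-- The classification applied to complements shows that the group is transitive on vectors of a
-- given nonzero value (`mem_orbit_iff`), so its order is the number of such vectors times the order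
-- of the group of the complement (`card_orthogonalGroupOf`). The vectors are counted by peeling off
-- hyperbolic planes (`exists_split_model`). The recursion alternates between odd dimension and plus
-- type; minus type is reached from odd dimension in one step. The two even orders differ, so the
-- groups are not isomorphic.

universe w u v

/-- Two bilinear forms are equivalent if some linear isomorphism carries one to the other. -/
def FormEquiv {F V W : Type*} [Field F] [AddCommGroup V] [Module F V] [AddCommGroup W] [Module F W]
    (f : LinearMap.BilinForm F V) (g : LinearMap.BilinForm F W) : Prop :=
  ∃ e : V ≃ₗ[F] W, ∀ u v, g (e u) (e v) = f u v

/-- The orthogonal direct sum of two bilinear forms. -/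
def sumForm {F V W : Type*} [Field F] [AddCommGroup V] [Module F V] [AddCommGroup W] [Module F W]
    (f : LinearMap.BilinForm F V) (g : LinearMap.BilinForm F W) : LinearMap.BilinForm F (V × W) :=
  f.compl₁₂ (LinearMap.fst F V W) (LinearMap.fst F V W) +
    g.compl₁₂ (LinearMap.snd F V W) (LinearMap.snd F V W)

/-- The form `c x y` on the line. -/
def lineForm {F : Type*} [Field F] (c : F) : LinearMap.BilinForm F F := c • LinearMap.mul F F

/-- The hyperbolic plane. -/
def hypForm (F : Type*) [Field F] : LinearMap.BilinForm F (F × F) :=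
  (LinearMap.mul F F).compl₁₂ (LinearMap.fst F F F) (LinearMap.snd F F F) +
    (LinearMap.mul F F).compl₁₂ (LinearMap.snd F F F) (LinearMap.fst F F F)

/-- `d` is the determinant of the Gram matrix of `f` in some basis. -/
def HasGramDet {F V : Type*} [Field F] [AddCommGroup V] [Module F V]
    (f : LinearMap.BilinForm F V) (d : F) : Prop :=
  ∃ (n : ℕ) (b : Module.Basis (Fin n) F V), (LinearMap.BilinForm.toMatrix b f).det = d

/-! ### Gram determinants, orthogonal sums and splitting off a line -/

section Basic

variable {F V W V' W' : Type*} [Field F] [AddCommGroup V] [Module F V] [AddCommGroup W] [Module F W]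
  [AddCommGroup V'] [Module F V'] [AddCommGroup W'] [Module F W']

@[simp] lemma sumForm_apply (f : LinearMap.BilinForm F V) (g : LinearMap.BilinForm F W)
    (x y : V × W) : sumForm f g x y = f x.1 y.1 + g x.2 y.2 := rfl

@[simp] lemma lineForm_apply (c x y : F) : lineForm c x y = c * (x * y) := rfl

@[simp] lemma hypForm_apply (x y : F × F) : hypForm F x y = x.1 * y.2 + x.2 * y.1 := rfl

lemma FormEquiv.symm {f : LinearMap.BilinForm F V} {g : LinearMap.BilinForm F W}
    (h : FormEquiv f g) : FormEquiv g f := by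
  obtain ⟨e, he⟩ := h
  exact ⟨e.symm, fun u v => by simp [← he]⟩

lemma FormEquiv.trans {f : LinearMap.BilinForm F V} {g : LinearMap.BilinForm F W}
    {k : LinearMap.BilinForm F V'} (h : FormEquiv f g) (h' : FormEquiv g k) : FormEquiv f k := by
  obtain ⟨e, he⟩ := h
  obtain ⟨e', he'⟩ := h'
  exact ⟨e.trans e', fun u v => by simp [he, he']⟩

lemma FormEquiv.sum {f : LinearMap.BilinForm F V} {g : LinearMap.BilinForm F W}
    {f' : LinearMap.BilinForm F V'} {g' : LinearMap.BilinForm F W'}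
    (h : FormEquiv f f') (h' : FormEquiv g g') : FormEquiv (sumForm f g) (sumForm f' g') := by
  obtain ⟨e, he⟩ := h
  obtain ⟨e', he'⟩ := h'
  exact ⟨e.prodCongr e', fun u v => by simp [he, he']⟩

lemma HasGramDet.of_basis {ι : Type*} [Fintype ι] [DecidableEq ι] (b : Module.Basis ι F V)
    (f : LinearMap.BilinForm F V) : HasGramDet f (LinearMap.BilinForm.toMatrix b f).det := by
  refine ⟨Fintype.card ι, b.reindex (Fintype.equivFin ι), ?_⟩
  rw [← Matrix.det_reindex_self (Fintype.equivFin ι)]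
  congr 1
  ext i j
  simp [LinearMap.BilinForm.toMatrix_apply]

lemma exists_hasGramDet [FiniteDimensional F V] (f : LinearMap.BilinForm F V) :
    ∃ d, HasGramDet f d :=
  ⟨_, HasGramDet.of_basis (Module.finBasis F V) f⟩

/-- A change of basis `P` turns the Gram matrix `G` into `Pᵀ G P`; the discriminant is therefore
well defined modulo squares. -/
lemma HasGramDet.exists_sq {f : LinearMap.BilinForm F V} {d d' : F}
    (h : HasGramDet f d) (h' : HasGramDet f d') : ∃ a, d' = a ^ 2 * d := by
  obtain ⟨n, b, rfl⟩ := h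
  obtain ⟨n', b', rfl⟩ := h'
  obtain rfl : n = n' := by
    have h1 := Module.finrank_eq_card_basis b
    have h2 := Module.finrank_eq_card_basis b'
    simp at h1 h2
    omega
  refine ⟨(b.toMatrix b').det, ?_⟩
  rw [← LinearMap.BilinForm.toMatrix_mul_basis_toMatrix b b' f]
  simp only [Matrix.det_mul, Matrix.det_transpose]
  ring

lemma HasGramDet.isSquare_mul {f : LinearMap.BilinForm F V} {d d' : F}
    (h : HasGramDet f d) (h' : HasGramDet f d') : IsSquare (d * d') := by
  obtain ⟨a, rfl⟩ := h.exists_sq h'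
  exact ⟨a * d, by ring⟩

lemma HasGramDet.ne_zero {f : LinearMap.BilinForm F V} {d : F}
    (h : HasGramDet f d) (hf : IsOrthogonalForm f) : d ≠ 0 := by
  obtain ⟨n, b, rfl⟩ := h
  exact (LinearMap.BilinForm.nondegenerate_iff_det_ne_zero b).1 hf.2

lemma HasGramDet.isOrthogonalForm {f : LinearMap.BilinForm F V} {d : F}
    (h : HasGramDet f d) (hd : d ≠ 0) (hf : f.IsSymm) : IsOrthogonalForm f := by
  obtain ⟨n, b, rfl⟩ := h
  exact ⟨hf, (LinearMap.BilinForm.nondegenerate_iff_det_ne_zero b).2 hd⟩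

lemma HasGramDet.map {f : LinearMap.BilinForm F V} {g : LinearMap.BilinForm F W} {d : F}
    (h : HasGramDet f d) (hfg : FormEquiv f g) : HasGramDet g d := by
  obtain ⟨n, b, rfl⟩ := h
  obtain ⟨e, he⟩ := hfg
  refine ⟨n, b.map e, ?_⟩
  congr 1
  ext i j
  simp [LinearMap.BilinForm.toMatrix_apply, he]

lemma HasGramDet.sum {f : LinearMap.BilinForm F V} {g : LinearMap.BilinForm F W} {d e : F}
    (h : HasGramDet f d) (h' : HasGramDet g e) : HasGramDet (sumForm f g) (d * e) := by
  obtain ⟨n, b, rfl⟩ := h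
  obtain ⟨n', b', rfl⟩ := h'
  have := HasGramDet.of_basis (b.prod b') (sumForm f g)
  convert this using 1
  rw [← Matrix.det_fromBlocks_zero₁₂ _ 0 _]
  congr 1
  ext i j
  rcases i with i | i <;> rcases j with j | j <;> simp [LinearMap.BilinForm.toMatrix_apply]

lemma HasGramDet.smul {f : LinearMap.BilinForm F V} {d : F} (h : HasGramDet f d) (c : F) :
    HasGramDet (c • f) (c ^ Module.finrank F V * d) := by
  obtain ⟨n, b, rfl⟩ := h
  refine ⟨n, b, ?_⟩
  rw [map_smul, Matrix.det_smul, Module.finrank_eq_card_basis b]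

lemma lineForm_hasGramDet (c : F) : HasGramDet (lineForm c) c := by
  have := HasGramDet.of_basis (Module.Basis.singleton Unit F) (lineForm c)
  simpa [LinearMap.BilinForm.toMatrix_apply] using this

lemma hypForm_hasGramDet : HasGramDet (hypForm F) (-1) := by
  have := HasGramDet.of_basis
    ((Module.Basis.singleton Unit F).prod (Module.Basis.singleton Unit F)) (hypForm F)
  convert this using 1
  rw [← Matrix.det_reindex_self (finSumFinEquiv.symm.trans
    (Equiv.sumCongr (Equiv.ofUnique (Fin 1) Unit) (Equiv.ofUnique (Fin 1) Unit))).symm,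
    Matrix.det_fin_two]
  have h0 : (finSumFinEquiv (m := 1) (n := 1)).symm 0 = Sum.inl 0 := rfl
  have h1 : (finSumFinEquiv (m := 1) (n := 1)).symm 1 = Sum.inr 0 := rfl
  simp [LinearMap.BilinForm.toMatrix_apply, h0, h1]

lemma hasGramDet_one_of_finrank_eq_zero [FiniteDimensional F V] (f : LinearMap.BilinForm F V)
    (h : Module.finrank F V = 0) : HasGramDet f 1 :=
  ⟨0, Module.finBasisOfFinrankEq F V h, by simp⟩

lemma IsOrthogonalForm.of_formEquiv {f : LinearMap.BilinForm F V} {g : LinearMap.BilinForm F W}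
    (hf : IsOrthogonalForm f) (h : FormEquiv f g) : IsOrthogonalForm g := by
  obtain ⟨e, he⟩ := h.symm
  refine ⟨⟨fun x y => by rw [← he, ← he, hf.1.eq]⟩, fun x hx => ?_, fun x hx => ?_⟩
  · refine (map_eq_zero_iff e e.injective).1 (hf.2.1 _ fun y => ?_)
    rw [← hx (e.symm y), ← he, e.apply_symm_apply]
  · refine (map_eq_zero_iff e e.injective).1 (hf.2.2 _ fun y => ?_)
    rw [← hx (e.symm y), ← he, e.apply_symm_apply]

lemma isOrthogonalForm_of_symm_of_left {f : LinearMap.BilinForm F V}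
    (hf : f.IsSymm) (h : ∀ u, (∀ v, f u v = 0) → u = 0) : IsOrthogonalForm f :=
  ⟨hf, h, fun u hu => h u fun v => by rw [hf.eq, hu]⟩

lemma IsOrthogonalForm.sum {f : LinearMap.BilinForm F V} {g : LinearMap.BilinForm F W}
    (hf : IsOrthogonalForm f) (hg : IsOrthogonalForm g) : IsOrthogonalForm (sumForm f g) := by
  refine isOrthogonalForm_of_symm_of_left ⟨fun x y => ?_⟩ fun u hu => Prod.ext ?_ ?_
  · simp [hf.1.eq x.1, hg.1.eq x.2]
  · exact hf.2.1 _ fun v => by simpa using hu (v, 0)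
  · exact hg.2.1 _ fun v => by simpa using hu (0, v)

lemma IsOrthogonalForm.right_of_sum {f : LinearMap.BilinForm F V} {g : LinearMap.BilinForm F W}
    (h : IsOrthogonalForm (sumForm f g)) : IsOrthogonalForm g := by
  refine isOrthogonalForm_of_symm_of_left ⟨fun x y => ?_⟩ fun u hu => ?_
  · simpa using h.1.eq (0, x) (0, y)
  · have := h.2.1 (0, u) fun v => by simp [hu]
    exact congrArg Prod.snd this

lemma IsOrthogonalForm.smul {f : LinearMap.BilinForm F V} (hf : IsOrthogonalForm f) {c : F}
    (hc : c ≠ 0) : IsOrthogonalForm (c • f) := by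
  refine isOrthogonalForm_of_symm_of_left ⟨fun x y => ?_⟩ fun u hu => hf.2.1 u fun v => ?_
  · simp [hf.1.eq x]
  · simpa [hc] using hu v

lemma isOrthogonalForm_lineForm {c : F} (hc : c ≠ 0) : IsOrthogonalForm (lineForm c) :=
  (lineForm_hasGramDet c).isOrthogonalForm hc ⟨fun x y => by simp [mul_comm]⟩

lemma isOrthogonalForm_hypForm : IsOrthogonalForm (hypForm F) :=
  hypForm_hasGramDet.isOrthogonalForm (by simp) ⟨fun x y => by simp; ring⟩

/-- A vector with nonzero value splits off a line, with complement its orthogonal space. -/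
def splitEquiv (f : LinearMap.BilinForm F V) (v : V) (hv : f v v ≠ 0) :
    (F × LinearMap.ker (f v)) ≃ₗ[F] V where
  toFun x := x.1 • v + x.2
  map_add' x y := by simp [add_smul]; abel
  map_smul' a x := by simp [mul_smul]
  invFun u := (f v u / f v v, ⟨u - (f v u / f v v) • v, by simp [hv]⟩)
  left_inv x := by
    have h := x.2.2
    rw [LinearMap.mem_ker] at h
    ext <;> simp [h, hv]
  right_inv u := by simp

lemma splitEquiv_one_zero (f : LinearMap.BilinForm F V) (v : V) (hv : f v v ≠ 0) :
    splitEquiv f v hv (1, 0) = v := by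
  simp [splitEquiv]

lemma splitEquiv_form {f : LinearMap.BilinForm F V} (hf : f.IsSymm) (v : V) (hv : f v v ≠ 0)
    (x y) : f (splitEquiv f v hv x) (splitEquiv f v hv y) =
      sumForm (lineForm (f v v)) (f.restrict (LinearMap.ker (f v))) x y := by
  have hx := x.2.2
  have hy := y.2.2
  rw [LinearMap.mem_ker] at hx hy
  simp [splitEquiv, hy, hf.eq _ v, hx]
  ring

lemma exists_split {f : LinearMap.BilinForm F V} (hf : IsOrthogonalForm f) (v : V)
    (hv : f v v ≠ 0) :
    IsOrthogonalForm (f.restrict (LinearMap.ker (f v))) ∧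
      FormEquiv (sumForm (lineForm (f v v)) (f.restrict (LinearMap.ker (f v)))) f := by
  have h : FormEquiv (sumForm (lineForm (f v v)) (f.restrict (LinearMap.ker (f v)))) f :=
    ⟨splitEquiv f v hv, splitEquiv_form hf.1 v hv⟩
  exact ⟨(hf.of_formEquiv h.symm).right_of_sum, h⟩

lemma finrank_ker_add_one [FiniteDimensional F V] (f : LinearMap.BilinForm F V) (v : V)
    (hv : f v v ≠ 0) : Module.finrank F (LinearMap.ker (f v)) + 1 = Module.finrank F V := by
  rw [← (splitEquiv f v hv).finrank_eq]
  simp [add_comm]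

/-- Polarization: if all `f v v` vanish, then so does `2 * f u v`. -/
lemma exists_self_ne_zero (h2 : (2 : F) ≠ 0) [FiniteDimensional F V]
    {f : LinearMap.BilinForm F V} (hf : IsOrthogonalForm f) (hV : Module.finrank F V ≠ 0) :
    ∃ v, f v v ≠ 0 := by
  by_contra! h
  have : Nontrivial V := Module.nontrivial_of_finrank_pos (R := F) (by omega)
  obtain ⟨u, hu⟩ := exists_ne (0 : V)
  refine hu (hf.2.1 u fun v => ?_)
  have := h (u + v)
  simp only [map_add, LinearMap.add_apply, h, hf.1.eq v u, zero_add, add_zero] at this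
  rw [← two_mul] at this
  simpa [h2] using this

lemma exists_sq_sum [Finite F] (hF : ringChar F ≠ 2) {a b : F} (ha : a ≠ 0) (hb : b ≠ 0) (c : F) :
    ∃ x y, a * x ^ 2 + b * y ^ 2 = c := by
  have := Fintype.ofFinite F
  obtain ⟨x, y, h⟩ := FiniteField.exists_root_sum_quadratic
    (f := Polynomial.C a * Polynomial.X ^ 2 + Polynomial.C 0 * Polynomial.X + Polynomial.C (-c))
    (g := Polynomial.C b * Polynomial.X ^ 2 + Polynomial.C 0 * Polynomial.X + Polynomial.C 0)
    (Polynomial.degree_quadratic ha) (Polynomial.degree_quadratic hb)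
    (FiniteField.odd_card_of_char_ne_two hF)
  refine ⟨x, y, ?_⟩
  simp at h
  linear_combination h

/-- Two orthogonal vectors of nonzero value span a binary diagonal form, which is universal by
`exists_sq_sum`. -/
lemma exists_self_eq [Finite F] (hF : ringChar F ≠ 2) [FiniteDimensional F V]
    {f : LinearMap.BilinForm F V} (hf : IsOrthogonalForm f) (hV : 2 ≤ Module.finrank F V) (c : F) :
    ∃ v, f v v = c := by
  have h2 : (2 : F) ≠ 0 := Ring.two_ne_zero hF
  obtain ⟨v, hv⟩ := exists_self_ne_zero h2 hf (by omega)
  have hr := finrank_ker_add_one f v hv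
  obtain ⟨w, hw⟩ := exists_self_ne_zero h2 (exists_split hf v hv).1 (by omega)
  obtain ⟨x, y, h⟩ := exists_sq_sum hF hv hw c
  refine ⟨splitEquiv f v hv (x, y • w), ?_⟩
  rw [splitEquiv_form hf.1, ← h]
  simp
  ring

end Basic

/-! ### Classification by dimension and discriminant -/

/-- Symmetric nonsingular forms over a finite field of odd characteristic are classified by
their dimension and their discriminant. -/
theorem formEquiv_of_isSquare {F : Type w} [Field F] [Finite F] (hF : ringChar F ≠ 2) (n : ℕ) :
    ∀ {V : Type u} {V' : Type v} [AddCommGroup V] [Module F V] [FiniteDimensional F V]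
      [AddCommGroup V'] [Module F V'] [FiniteDimensional F V']
      {f : LinearMap.BilinForm F V} {f' : LinearMap.BilinForm F V'} {d d' : F},
      Module.finrank F V = n → Module.finrank F V' = n →
      IsOrthogonalForm f → IsOrthogonalForm f' → HasGramDet f d → HasGramDet f' d' →
      IsSquare (d * d') → FormEquiv f f' := by
  have h2 : (2 : F) ≠ 0 := Ring.two_ne_zero hF
  induction n with
  | zero =>
    intro V V' _ _ _ _ _ _ f f' d d' hV hV' _ _ _ _ _
    have := Module.finrank_zero_iff.1 hV
    refine ⟨LinearEquiv.ofFinrankEq V V' (hV.trans hV'.symm), fun x y => ?_⟩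
    simp [Subsingleton.elim x 0]
  | succ n ih =>
    intro V V' _ _ _ _ _ _ f f' d d' hV hV' hf hf' hd hd' hdd
    obtain ⟨v, v', hv, hvv⟩ : ∃ v v', f v v ≠ 0 ∧ f' v' v' = f v v := by
      rcases Nat.eq_zero_or_pos n with rfl | hn
      · obtain ⟨v, hv⟩ := exists_self_ne_zero h2 hf (by omega)
        obtain ⟨v', hv'⟩ := exists_self_ne_zero h2 hf' (by omega)
        have e1 := ((lineForm_hasGramDet (f v v)).sum (hasGramDet_one_of_finrank_eq_zero _
          (by have := finrank_ker_add_one f v hv; omega))).map (exists_split hf v hv).2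
        have e2 := ((lineForm_hasGramDet (f' v' v')).sum (hasGramDet_one_of_finrank_eq_zero _
          (by have := finrank_ker_add_one f' v' hv'; omega))).map (exists_split hf' v' hv').2
        obtain ⟨a, ha⟩ := hd.exists_sq e1
        obtain ⟨a', ha'⟩ := hd'.exists_sq e2
        obtain ⟨s, hs⟩ := hdd
        rw [mul_one] at ha ha'
        -- On a line not every value is taken, but both values represent the discriminants, so their
        -- product is the square of `a * a' * s`; this dictates the scaling of `v'`.
        refine ⟨v, (a * a' * s / f' v' v') • v', hv, ?_⟩
        simp only [map_smul, LinearMap.smul_apply, smul_eq_mul]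
        field_simp
        have : f v v * f' v' v' = a ^ 2 * a' ^ 2 * (d * d') := by rw [ha, ha']; ring
        linear_combination -this - a ^ 2 * a' ^ 2 * hs
      · obtain ⟨v, hv⟩ := exists_self_eq hF hf (by omega) 1
        obtain ⟨v', hv'⟩ := exists_self_eq hF hf' (by omega) 1
        exact ⟨v, v', by simp [hv], by rw [hv, hv']⟩
    have hv' : f' v' v' ≠ 0 := by rwa [hvv]
    obtain ⟨ho, he⟩ := exists_split hf v hv
    obtain ⟨ho', he'⟩ := exists_split hf' v' hv'
    obtain ⟨e, hge⟩ := exists_hasGramDet (f.restrict (LinearMap.ker (f v)))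
    obtain ⟨e', hge'⟩ := exists_hasGramDet (f'.restrict (LinearMap.ker (f' v')))
    have r1 := finrank_ker_add_one f v hv
    have r2 := finrank_ker_add_one f' v' hv'
    have hs : IsSquare (e * e') := by
      obtain ⟨a, ha⟩ := hd.exists_sq (((lineForm_hasGramDet (f v v)).sum hge).map he)
      obtain ⟨a', ha'⟩ := hd'.exists_sq (((lineForm_hasGramDet (f' v' v')).sum hge').map he')
      obtain ⟨s, hs⟩ := hdd
      refine ⟨a * a' * s / f v v, ?_⟩
      field_simp
      rw [hvv] at ha'
      have : f v v ^ 2 * (e * e') = a ^ 2 * a' ^ 2 * (d * d') := by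
        calc _ = (f v v * e) * (f v v * e') := by ring
          _ = _ := by rw [ha, ha']; ring
      linear_combination this + a ^ 2 * a' ^ 2 * hs
    have hg := ih (by omega) (by omega) ho ho' hge hge' hs
    refine he.symm.trans (FormEquiv.trans ?_ he')
    rw [hvv]
    exact FormEquiv.sum ⟨LinearEquiv.refl F F, fun _ _ => rfl⟩ hg

/-! ### Totally isotropic subspaces and the discriminant -/

section Isotropic

variable {F V W : Type*} [Field F] [AddCommGroup V] [Module F V] [AddCommGroup W] [Module F W]

lemma HasTotallyIsotropic.of_formEquiv {f : LinearMap.BilinForm F V} {g : LinearMap.BilinForm F W}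
    {m : ℕ} (h : HasTotallyIsotropic f m) (hfg : FormEquiv f g) : HasTotallyIsotropic g m := by
  obtain ⟨U, hU, hiso⟩ := h
  obtain ⟨e, he⟩ := hfg
  refine ⟨U.map (e : V →ₗ[F] W), by rw [← hU]; exact LinearEquiv.finrank_map_eq e U, ?_⟩
  rintro _ ⟨u, hu, rfl⟩ _ ⟨v, hv, rfl⟩
  simpa [he] using hiso u hu v hv

lemma HasTotallyIsotropic.hypForm_sum [FiniteDimensional F W] {g : LinearMap.BilinForm F W}
    {m : ℕ} (h : HasTotallyIsotropic g m) :
    HasTotallyIsotropic (sumForm (hypForm F) g) (m + 1) := by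
  obtain ⟨U, hU, hiso⟩ := h
  let φ : (F × U) →ₗ[F] (F × F) × W := (LinearMap.inl F F F).prodMap U.subtype
  have hφ : Function.Injective φ :=
    Function.Injective.prodMap LinearMap.inl_injective U.injective_subtype
  refine ⟨LinearMap.range φ, ?_, ?_⟩
  · rw [LinearMap.finrank_range_of_inj hφ]
    simp [hU, add_comm]
  · rintro _ ⟨u, rfl⟩ _ ⟨v, rfl⟩
    simp [φ, hiso u.2 u.2.2 v.2 v.2.2]

lemma det_fromBlocks_zero_one_one_zero (m : ℕ) :
    (Matrix.fromBlocks 0 1 1 0 : Matrix (Fin m ⊕ Fin m) (Fin m ⊕ Fin m) F).det = (-1) ^ m := by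
  have h : (Matrix.fromBlocks 0 1 1 0 : Matrix (Fin m ⊕ Fin m) (Fin m ⊕ Fin m) F) *
      Matrix.fromBlocks 1 0 1 1 = Matrix.fromBlocks 1 1 1 0 := by
    simp [Matrix.fromBlocks_multiply]
  have h' := congrArg Matrix.det h
  rw [Matrix.det_mul, Matrix.det_fromBlocks_zero₁₂, Matrix.det_fromBlocks_one₁₁] at h'
  simpa [Matrix.det_neg] using h'

/-- A form of dimension `2m` with a totally isotropic subspace of dimension `m` has
discriminant `(-1)^m`. -/
lemma HasTotallyIsotropic.isSquare [FiniteDimensional F V] {f : LinearMap.BilinForm F V} {m : ℕ}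
    (h : HasTotallyIsotropic f m) (hf : f.IsSymm) (hV : Module.finrank F V = 2 * m) {d : F}
    (hd : HasGramDet f d) : IsSquare ((-1) ^ m * d) := by
  obtain ⟨U, hU, hiso⟩ := h
  obtain ⟨C, hC⟩ := U.exists_isCompl
  have hC' : Module.finrank F C = m := by
    have := Submodule.finrank_add_eq_of_isCompl hC
    omega
  let b := ((Module.finBasisOfFinrankEq F U hU).prod (Module.finBasisOfFinrankEq F C hC')).map
    (Submodule.prodEquivOfIsCompl U C hC)
  let G := LinearMap.BilinForm.toMatrix b f
  have hG11 : G.toBlocks₁₁ = 0 := by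
    ext i j
    simp only [Matrix.toBlocks₁₁, G, LinearMap.BilinForm.toMatrix_apply, Matrix.of_apply,
      Matrix.zero_apply]
    refine hiso _ ?_ _ ?_ <;> simp [b]
  have hG12 : G.toBlocks₂₁ = G.toBlocks₁₂.transpose := by
    ext i j
    simp [Matrix.toBlocks₁₂, Matrix.toBlocks₂₁, G, LinearMap.BilinForm.toMatrix_apply]
    exact hf.eq _ _
  -- Swapping the two block columns moves the zero block off the diagonal, so the determinant
  -- becomes the square of that of the off-diagonal block.
  have hmul : G * Matrix.fromBlocks 0 1 1 0 =
      Matrix.fromBlocks G.toBlocks₁₂ 0 G.toBlocks₂₂ G.toBlocks₁₂.transpose := by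
    rw [← hG12, ← hG11]
    conv_lhs => rw [← Matrix.fromBlocks_toBlocks G]
    simp [Matrix.fromBlocks_multiply, hG11]
  have hdet := congrArg Matrix.det hmul
  rw [Matrix.det_mul, det_fromBlocks_zero_one_one_zero, Matrix.det_fromBlocks_zero₁₂,
    Matrix.det_transpose] at hdet
  obtain ⟨a, rfl⟩ := (HasGramDet.of_basis b f).exists_sq hd
  refine ⟨a * G.toBlocks₁₂.det, ?_⟩
  change (-1) ^ m * (a ^ 2 * G.det) = _
  linear_combination a ^ 2 * hdet

end Isotropic

/-! ### Counting vectors of a given value -/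

/-- The number of vectors at which the quadratic form of `f` takes the value `c`. -/
noncomputable def valueCount {F V : Type*} [Field F] [AddCommGroup V] [Module F V]
    (f : LinearMap.BilinForm F V) (c : F) : ℕ := Nat.card {v // f v v = c}

section Count

variable {F V W : Type*} [Field F] [AddCommGroup V] [Module F V] [AddCommGroup W] [Module F W]

lemma valueCount_congr {f : LinearMap.BilinForm F V} {g : LinearMap.BilinForm F W}
    (h : FormEquiv f g) (c : F) : valueCount f c = valueCount g c := by
  obtain ⟨e, he⟩ := h
  exact Nat.card_congr (e.toEquiv.subtypeEquiv fun v => by simp [he])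

lemma valueCount_smul_sq (f : LinearMap.BilinForm F V) (c : F) {z : F} (hz : z ≠ 0) :
    valueCount f (z ^ 2 * c) = valueCount f c := by
  refine (Nat.card_congr ((LinearEquiv.smulOfNeZero F V z hz).toEquiv.subtypeEquiv fun v => ?_)).symm
  simp only [LinearEquiv.coe_toEquiv, LinearEquiv.smulOfNeZero_apply, map_smul,
    LinearMap.smul_apply, smul_eq_mul, ← mul_assoc, ← pow_two]
  exact (mul_right_inj' (pow_ne_zero 2 hz)).symm

lemma valueCount_eq_sum [Fintype V] (f : LinearMap.BilinForm F V) (c : F)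
    [DecidablePred fun v => f v v = c] :
    valueCount f c = ∑ v, if f v v = c then 1 else 0 := by
  rw [valueCount, Nat.card_eq_fintype_card, Fintype.card_subtype, Finset.card_filter]

lemma valueCount_sum [Finite V] [Fintype W] (f : LinearMap.BilinForm F V)
    (g : LinearMap.BilinForm F W) (c : F) :
    valueCount (sumForm f g) c = ∑ w, valueCount f (c - g w w) := by
  classical
  have := Fintype.ofFinite V
  rw [valueCount_eq_sum, Fintype.sum_prod_type_right]
  refine Finset.sum_congr rfl fun w _ => ?_
  rw [valueCount_eq_sum]
  exact Finset.sum_congr rfl fun v _ => if_congr eq_sub_iff_add_eq.symm rfl rfl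

/-- In `2xy = t` each nonzero `x` determines `y`, while `x = 0` allows every `y` if `t = 0` and none
otherwise. -/
lemma valueCount_hypForm [Finite F] [DecidableEq F] (h2 : (2 : F) ≠ 0) (t : F) :
    valueCount (hypForm F) t = (Nat.card F - 1) + if t = 0 then Nat.card F else 0 := by
  have := Fintype.ofFinite F
  have key (x : F) : (∑ y : F, if x * y + y * x = t then 1 else 0) =
      if x = 0 then (if t = 0 then Nat.card F else 0) else 1 := by
    split_ifs with hx ht
    · simp [hx, ht]
    · simp [hx, Ne.symm ht]
    · refine Eq.trans ?_ ((Finset.sum_ite_eq' Finset.univ (t / (2 * x)) (fun _ => 1)).trans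
        (if_pos (Finset.mem_univ _)))
      refine Finset.sum_congr rfl fun y _ => if_congr ?_ rfl rfl
      rw [eq_div_iff (mul_ne_zero h2 hx)]
      constructor <;> intro h <;> linear_combination h
  rw [valueCount_eq_sum, Fintype.sum_prod_type]
  refine (Finset.sum_congr rfl fun x _ => key x).trans ?_
  rw [← Finset.add_sum_erase _ _ (Finset.mem_univ (0 : F)), add_comm]
  congr 1
  · rw [Finset.sum_congr rfl fun x hx => if_neg (Finset.ne_of_mem_erase hx)]
    simp [Finset.card_erase_of_mem]
  · simp

lemma valueCount_hypForm_sum [Finite F] [FiniteDimensional F W] (h2 : (2 : F) ≠ 0)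
    (g : LinearMap.BilinForm F W) (c : F) :
    valueCount (sumForm (hypForm F) g) c =
      (Nat.card F - 1) * Nat.card F ^ Module.finrank F W + Nat.card F * valueCount g c := by
  classical
  have : Finite W := Module.finite_of_finite F
  have := Fintype.ofFinite W
  rw [valueCount_sum, valueCount_eq_sum]
  simp_rw [valueCount_hypForm h2, Finset.sum_add_distrib, Finset.mul_sum, sub_eq_zero]
  rw [← Module.natCard_eq_pow_finrank (K := F) (V := W)]
  simp [mul_comm, eq_comm]

lemma valueCount_lineForm (h2 : (2 : F) ≠ 0) {c : F} (hc : c ≠ 0) :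
    valueCount (lineForm c) c = 2 := by
  have h : {x : F | lineForm c x x = c} = {1, -1} := by
    ext x
    simp only [lineForm_apply, Set.mem_ofPred_eq, Set.mem_insert_iff, Set.mem_singleton_iff]
    rw [mul_eq_left₀ hc, mul_self_eq_one_iff]
  have hne : (1 : F) ≠ -1 := fun h => h2 (by linear_combination h)
  change Nat.card ({x : F | lineForm c x x = c} : Set F) = 2
  rw [h, Nat.card_coe_set_eq, Set.ncard_pair hne]

lemma valueCount_of_finrank_eq_zero [FiniteDimensional F V] (f : LinearMap.BilinForm F V)
    (h : Module.finrank F V = 0) {c : F} (hc : c ≠ 0) : valueCount f c = 0 := by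
  have := Module.finrank_zero_iff.1 h
  rw [valueCount, Nat.card_eq_zero]
  refine Or.inl ⟨fun v => hc ?_⟩
  rw [← v.2, Subsingleton.elim v.1 0]
  simp

/-- The number of solutions of `x² - εy² = 1` for a nonsquare `ε`. -/
lemma valueCount_anisotropic [Finite F] (hF : ringChar F ≠ 2) {ε : F} (hε : ¬ IsSquare ε) :
    valueCount (sumForm (lineForm 1) (lineForm (-ε))) 1 = Nat.card F + 1 := by
  classical
  have h2 : (2 : F) ≠ 0 := Ring.two_ne_zero hF
  have := Fintype.ofFinite F
  have hε0 : ε ≠ 0 := by rintro rfl; exact hε IsSquare.zero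
  -- Both ternary forms have discriminant `ε`. Counting zeros on each side gives `1 + (q - 1) N = (q
  -- - 1) q + q`, with `N` the wanted number: on the left, a third coordinate `z ≠ 0` asks the
  -- anisotropic plane for the value `z ^ 2`, taken as often as 1.
  have hequiv : FormEquiv (sumForm (sumForm (lineForm 1) (lineForm (-ε))) (lineForm (-1)))
      (sumForm (hypForm F) (lineForm (-ε))) := by
    refine formEquiv_of_isSquare hF 3 (by simp) (by simp)
      (((isOrthogonalForm_lineForm one_ne_zero).sum (isOrthogonalForm_lineForm (by simpa))).sum
        (isOrthogonalForm_lineForm (by simp)))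
      (isOrthogonalForm_hypForm.sum (isOrthogonalForm_lineForm (by simpa)))
      (((lineForm_hasGramDet _).sum (lineForm_hasGramDet _)).sum (lineForm_hasGramDet _))
      (hypForm_hasGramDet.sum (lineForm_hasGramDet _)) ⟨ε, by ring⟩
  have h := valueCount_congr hequiv 0
  have hline : valueCount (lineForm (-ε)) 0 = 1 := by
    rw [valueCount_eq_sum]
    simp [hε0]
  have hzero : valueCount (sumForm (lineForm 1) (lineForm (-ε))) 0 = 1 := by
    rw [valueCount, Nat.card_eq_one_iff_unique]
    refine ⟨⟨?_⟩, ⟨0, by simp⟩⟩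
    have key (v : F × F) (hv : sumForm (lineForm 1) (lineForm (-ε)) v v = 0) : v = 0 := by
      simp only [sumForm_apply, lineForm_apply] at hv
      by_cases hy : v.2 = 0
      · refine Prod.ext ?_ hy
        simpa [hy] using hv
      · exact absurd ⟨v.1 / v.2, by field_simp; linear_combination -hv⟩ hε
    intro v w
    exact Subtype.ext ((key _ v.2).trans (key _ w.2).symm)
  have hsq (z : F) (hz : z ∈ Finset.univ.erase (0 : F)) :
      valueCount (sumForm (lineForm 1) (lineForm (-ε))) (0 - lineForm (-1) z z) =
        valueCount (sumForm (lineForm 1) (lineForm (-ε))) 1 := by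
    rw [← valueCount_smul_sq _ 1 (Finset.ne_of_mem_erase hz)]
    congr 1
    simp [pow_two]
  rw [valueCount_hypForm_sum h2, hline, valueCount_sum,
    ← Finset.add_sum_erase _ _ (Finset.mem_univ (0 : F)), Finset.sum_congr rfl hsq] at h
  have hq : 1 < Fintype.card F := Fintype.one_lt_card
  simp only [map_zero, sub_zero, hzero, Finset.sum_const, Finset.card_univ, smul_eq_mul,
    Finset.card_erase_of_mem (Finset.mem_univ (0 : F)), Module.finrank_self, pow_one, mul_one,
    Nat.card_eq_fintype_card] at h ⊢
  obtain ⟨r, hr⟩ : ∃ r, Fintype.card F = r + 2 := ⟨Fintype.card F - 2, by omega⟩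
  rw [hr, show r + 2 - 1 = r + 1 by omega] at h
  rw [hr]
  refine Nat.eq_of_mul_eq_mul_left (Nat.succ_pos r) ?_
  linarith

end Count

/-! ### Hyperbolic models and the resulting counts -/

/-- Adding `m` hyperbolic planes to a form. -/
lemma exists_hypForm_sum {F W : Type w} [Field F] [Finite F] (hF : ringChar F ≠ 2)
    [AddCommGroup W] [Module F W] [FiniteDimensional F W] {g : LinearMap.BilinForm F W}
    (hg : IsOrthogonalForm g) {d : F} (hd : HasGramDet g d) (m : ℕ) :
    ∃ (V : Type w) (_ : AddCommGroup V) (_ : Module F V) (_ : FiniteDimensional F V)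
      (f : LinearMap.BilinForm F V), Module.finrank F V = 2 * m + Module.finrank F W ∧
        IsOrthogonalForm f ∧ HasGramDet f ((-1) ^ m * d) ∧ HasTotallyIsotropic f m ∧
        ∀ c, (Nat.card F * valueCount f c + Nat.card F ^ (Module.finrank F W + m) : ℤ) =
          Nat.card F ^ (m + 1) * valueCount g c + Nat.card F ^ (Module.finrank F W + 2 * m) := by
  induction m with
  | zero =>
    exact ⟨W, _, _, ‹_›, g, by simp, hg, by simpa, ⟨⊥, by simp, by simp [IsTotallyIsotropic]⟩,
      fun c => by simp⟩
  | succ m ih =>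
    obtain ⟨V, _, _, _, f, hV, hf, hfd, hiso, hc⟩ := ih
    refine ⟨(F × F) × V, _, _, inferInstance, sumForm (hypForm F) f, ?_,
      isOrthogonalForm_hypForm.sum hf, ?_, hiso.hypForm_sum, fun c => ?_⟩
    · simp [hV]; ring
    · convert hypForm_hasGramDet.sum hfd using 1
      ring
    · have hq : 1 ≤ Nat.card F := Nat.card_pos
      rw [valueCount_hypForm_sum (Ring.two_ne_zero hF), hV]
      -- The invariant says that each hyperbolic plane multiplies the deviation of the count from `q
      -- ^ (dim - 1)` by `q`. It is stated multiplied through by `q`, so that `W = 0` needs no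
      -- negative exponent.
      push_cast [Nat.cast_sub hq]
      linear_combination (Nat.card F : ℤ) * hc c

lemma zero_isOrthogonalForm {F : Type*} [Field F] :
    IsOrthogonalForm (0 : LinearMap.BilinForm F (Fin 0 → F)) :=
  isOrthogonalForm_of_symm_of_left ⟨fun _ _ => rfl⟩ fun _ _ => Subsingleton.elim _ _

section Formula

variable {F : Type w} {V : Type u} [Field F] [Finite F] [AddCommGroup V] [Module F V]
  [FiniteDimensional F V]

/-- The discriminant condition makes `f` equivalent to `g` plus `m` hyperbolic planes. Taking `g`
zero, a line, or an anisotropic plane gives plus type, odd dimension and minus type. -/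
lemma exists_split_model (hF : ringChar F ≠ 2) {W : Type w}
    [AddCommGroup W] [Module F W] [FiniteDimensional F W] {g : LinearMap.BilinForm F W}
    (hg : IsOrthogonalForm g) {e : F} (he : HasGramDet g e) {f : LinearMap.BilinForm F V}
    (hf : IsOrthogonalForm f) {d : F} (hd : HasGramDet f d) {m : ℕ}
    (hV : Module.finrank F V = 2 * m + Module.finrank F W) (hde : IsSquare ((-1) ^ m * d * e)) :
    HasTotallyIsotropic f m ∧
      ∀ c, (Nat.card F * valueCount f c + Nat.card F ^ (Module.finrank F W + m) : ℤ) =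
        Nat.card F ^ (m + 1) * valueCount g c + Nat.card F ^ (Module.finrank F W + 2 * m) := by
  obtain ⟨U, _, _, _, k, hU, hk, hkd, hiso, hc⟩ := exists_hypForm_sum hF hg he m
  have h : FormEquiv k f := formEquiv_of_isSquare hF _ hU hV hk hf hkd hd
    (by convert hde using 1; ring)
  exact ⟨hiso.of_formEquiv h, fun c => by rw [← valueCount_congr h c]; exact hc c⟩

/-- A form of dimension `2m` has a totally isotropic subspace of dimension `m` exactly when its
discriminant is `(-1)^m`. -/
lemma hasTotallyIsotropic_iff (hF : ringChar F ≠ 2) {f : LinearMap.BilinForm F V}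
    (hf : IsOrthogonalForm f) {d : F} (hd : HasGramDet f d) {m : ℕ}
    (hV : Module.finrank F V = 2 * m) : HasTotallyIsotropic f m ↔ IsSquare ((-1) ^ m * d) :=
  ⟨fun h => h.isSquare hf.1 hV hd, fun h => (exists_split_model hF zero_isOrthogonalForm
    (hasGramDet_one_of_finrank_eq_zero _ (by simp)) hf hd (by simpa using hV) (by simpa)).1⟩

lemma valueCount_plus (hF : ringChar F ≠ 2) {f : LinearMap.BilinForm F V}
    (hf : IsOrthogonalForm f) {m : ℕ} (hV : Module.finrank F V = 2 * m)
    (h : HasTotallyIsotropic f m) {c : F} (hc : c ≠ 0) :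
    (Nat.card F * valueCount f c : ℤ) = Nat.card F ^ m * (Nat.card F ^ m - 1) := by
  obtain ⟨d, hd⟩ := exists_hasGramDet f
  have := (exists_split_model hF zero_isOrthogonalForm
    (hasGramDet_one_of_finrank_eq_zero _ (by simp)) hf hd (by simpa using hV)
    (by simpa using h.isSquare hf.1 hV hd)).2 c
  rw [valueCount_of_finrank_eq_zero (0 : LinearMap.BilinForm F (Fin 0 → F)) (by simp) hc] at this
  simp only [Module.finrank_fin_fun] at this
  push_cast at this
  linear_combination this

/-- The quadratic character is multiplicative and equals `-1` on nonsquares. -/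
lemma isSquare_mul_of_not {a b : F} (ha : ¬ IsSquare a)
    (hb : ¬ IsSquare b) : IsSquare (a * b) := by
  classical
  have := Fintype.ofFinite F
  have ha0 : a ≠ 0 := by rintro rfl; exact ha IsSquare.zero
  have hb0 : b ≠ 0 := by rintro rfl; exact hb IsSquare.zero
  rw [← quadraticChar_one_iff_isSquare (mul_ne_zero ha0 hb0), map_mul,
    quadraticChar_neg_one_iff_not_isSquare.2 ha, quadraticChar_neg_one_iff_not_isSquare.2 hb]
  norm_num

lemma valueCount_minus (hF : ringChar F ≠ 2) {f : LinearMap.BilinForm F V}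
    (hf : IsOrthogonalForm f) {m : ℕ} (hm : 1 ≤ m) (hV : Module.finrank F V = 2 * m)
    (h : ¬ HasTotallyIsotropic f m) :
    (Nat.card F * valueCount f 1 : ℤ) = Nat.card F ^ m * (Nat.card F ^ m + 1) := by
  obtain ⟨d, hd⟩ := exists_hasGramDet f
  rw [hasTotallyIsotropic_iff hF hf hd hV] at h
  obtain ⟨ε, hε⟩ := FiniteField.exists_nonsquare hF
  have hε0 : ε ≠ 0 := by rintro rfl; exact hε IsSquare.zero
  obtain ⟨m, rfl⟩ : ∃ k, m = k + 1 := ⟨m - 1, by omega⟩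
  -- By this the discriminant matches that of `m` hyperbolic planes (after the shift of `m`) plus
  -- the anisotropic plane `x² - εy²`.
  have hs := isSquare_mul_of_not h hε
  have := (exists_split_model hF (m := m)
    ((isOrthogonalForm_lineForm one_ne_zero).sum (isOrthogonalForm_lineForm (neg_ne_zero.2 hε0)))
    ((lineForm_hasGramDet _).sum (lineForm_hasGramDet _)) hf hd (by rw [hV]; simp; ring)
    (by convert hs using 1; ring)).2 1
  rw [valueCount_anisotropic hF hε] at this
  simp only [Module.finrank_prod, Module.finrank_self] at this
  push_cast at this
  linear_combination this

lemma valueCount_odd (hF : ringChar F ≠ 2) {f : LinearMap.BilinForm F V}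
    (hf : IsOrthogonalForm f) {d : F} (hd : HasGramDet f d) {m : ℕ}
    (hV : Module.finrank F V = 2 * m + 1) (hs : IsSquare ((-1) ^ m * d)) :
    (valueCount f 1 : ℤ) = Nat.card F ^ m * (Nat.card F ^ m + 1) := by
  have := (exists_split_model hF (isOrthogonalForm_lineForm one_ne_zero) (lineForm_hasGramDet 1)
    hf hd (by simpa using hV) (by simpa)).2 1
  rw [valueCount_lineForm (Ring.two_ne_zero hF) one_ne_zero] at this
  simp only [Module.finrank_self] at this
  have hq : (Nat.card F : ℤ) ≠ 0 := by exact_mod_cast Nat.card_pos.ne'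
  refine mul_left_cancel₀ hq ?_
  push_cast at this
  linear_combination this

end Formula

/-! ### Group isomorphisms, orbits and stabilizers -/

section Group

variable {F V W : Type*} [Field F] [AddCommGroup V] [Module F V] [AddCommGroup W] [Module F W]

lemma FormEquiv.nonempty_mulEquiv {f : LinearMap.BilinForm F V} {g : LinearMap.BilinForm F W}
    (h : FormEquiv f g) : Nonempty (orthogonalGroupOf f ≃* orthogonalGroupOf g) := by
  obtain ⟨e, he⟩ := h
  have he' (u v) : f (e.symm u) (e.symm v) = g u v := by simp [← he]
  exact ⟨{
    toFun a := ⟨e.symm.trans (a.1.trans e), fun u v => by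
      have := a.2 (e.symm u) (e.symm v)
      simpa [he, he'] using this⟩
    invFun a := ⟨e.trans (a.1.trans e.symm), fun u v => by
      have := a.2 (e u) (e v)
      simpa [he, he'] using this⟩
    left_inv a := by ext; simp
    right_inv a := by ext; simp
    map_mul' a b := by ext; simp }⟩

lemma orthogonalGroupOf_smul (f : LinearMap.BilinForm F V) {c : F} (hc : c ≠ 0) :
    orthogonalGroupOf (c • f) = orthogonalGroupOf f := by
  ext a
  change (∀ u v, c * f (a u) (a v) = c * f u v) ↔ ∀ u v, f (a u) (a v) = f u v
  simp [hc]

/-- Witt's theorem for one vector: the complements of `v` and `u` agree in dimension and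
discriminant, hence are equivalent, and such an equivalence glued to `v ↦ u` is an isometry of `V`.
-/
lemma mem_orbit_iff [Finite F] (hF : ringChar F ≠ 2) [FiniteDimensional F V]
    {f : LinearMap.BilinForm F V} (hf : IsOrthogonalForm f) (v : V) (hv : f v v ≠ 0) (u : V) :
    u ∈ MulAction.orbit (orthogonalGroupOf f) v ↔ f u u = f v v := by
  constructor
  · rintro ⟨a, rfl⟩
    exact a.2 v v
  · intro huv
    have hu : f u u ≠ 0 := by rwa [huv]
    obtain ⟨ho, he⟩ := exists_split hf v hv
    obtain ⟨ho', he'⟩ := exists_split hf u hu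
    obtain ⟨d, hd⟩ := exists_hasGramDet (f.restrict (LinearMap.ker (f v)))
    obtain ⟨d', hd'⟩ := exists_hasGramDet (f.restrict (LinearMap.ker (f u)))
    have r1 := finrank_ker_add_one f v hv
    have r2 := finrank_ker_add_one f u hu
    obtain ⟨s, hs⟩ := (((lineForm_hasGramDet _).sum hd).map he).isSquare_mul
      (((lineForm_hasGramDet _).sum hd').map he')
    have hdd : IsSquare (d * d') := by
      refine ⟨s / f v v, ?_⟩
      field_simp
      rw [huv] at hs
      linear_combination hs
    obtain ⟨k, hk⟩ := formEquiv_of_isSquare hF _ rfl (by omega) ho ho' hd hd' hdd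
    have hk' (x y) : sumForm (lineForm (f u u)) (f.restrict (LinearMap.ker (f u)))
        ((LinearEquiv.refl F F).prodCongr k x) ((LinearEquiv.refl F F).prodCongr k y) =
        sumForm (lineForm (f v v)) (f.restrict (LinearMap.ker (f v))) x y := by
      rw [sumForm_apply, sumForm_apply, ← hk, huv]
      rfl
    refine ⟨⟨(splitEquiv f v hv).symm.trans (((LinearEquiv.refl F F).prodCongr k).trans
      (splitEquiv f u hu)), fun x y => ?_⟩, ?_⟩
    · simp only [LinearEquiv.trans_apply]
      rw [splitEquiv_form hf.1 u hu, hk', ← splitEquiv_form hf.1 v hv, LinearEquiv.apply_symm_apply,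
        LinearEquiv.apply_symm_apply]
    · change splitEquiv f u hu (((LinearEquiv.refl F F).prodCongr k)
        ((splitEquiv f v hv).symm v)) = u
      rw [(LinearEquiv.symm_apply_eq _).2 (splitEquiv_one_zero f v hv).symm]
      simp [splitEquiv]

/-- The stabilizer of a vector with nonzero value is the orthogonal group of its complement. -/
lemma card_stabilizer [FiniteDimensional F V] {f : LinearMap.BilinForm F V}
    (hf : IsOrthogonalForm f) (v : V) (hv : f v v ≠ 0) :
    Nat.card (MulAction.stabilizer (orthogonalGroupOf f) v) =
      Nat.card (orthogonalGroupOf (f.restrict (LinearMap.ker (f v)))) := by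
  have ho := (exists_split hf v hv).1
  have hex (a : MulAction.stabilizer (orthogonalGroupOf f) v) :
      ∃ k : orthogonalGroupOf (f.restrict (LinearMap.ker (f v))), ∀ w, (k.1 w : V) = a.1.1 w := by
    have hav : a.1.1 v = v := a.2
    have hmem (w) (hw : w ∈ LinearMap.ker (f v)) : (a.1.1 : V →ₗ[F] V) w ∈ LinearMap.ker (f v) := by
      have := a.1.2 v w
      rw [hav] at this
      rw [LinearMap.mem_ker] at hw ⊢
      exact this.trans hw
    obtain ⟨k, hk, hka⟩ := mem_orthogonalGroupOf_of_linear _ ho.2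
      ((a.1.1 : V →ₗ[F] V).restrict hmem) (fun x y => a.1.2 x y)
    exact ⟨⟨k, hk⟩, fun w => congrArg Subtype.val (hka w)⟩
  choose φ hφ using hex
  refine Nat.card_eq_of_bijective φ ⟨fun a b hab => ?_, fun k => ?_⟩
  · have hav : a.1.1 v = v := a.2
    have hbv : b.1.1 v = v := b.2
    refine Subtype.ext (Subtype.ext (LinearEquiv.ext fun u => ?_))
    obtain ⟨x, rfl⟩ := (splitEquiv f v hv).surjective u
    have h1 := hφ a x.2
    rw [hab, hφ b x.2] at h1
    change a.1.1 (x.1 • v + x.2) = b.1.1 (x.1 • v + x.2)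
    rw [map_add, map_add, map_smul, map_smul, hav, hbv, h1]
  · let S := splitEquiv f v hv
    have hS (y) : S y = y.1 • v + y.2 := rfl
    have hS' (w : LinearMap.ker (f v)) : S.symm w = (0, w) := by
      rw [LinearEquiv.symm_apply_eq, hS]
      simp
    have hSv : S.symm v = (1, 0) := by
      rw [LinearEquiv.symm_apply_eq, hS]
      simp
    let a : orthogonalGroupOf f := ⟨S.symm.trans (((LinearEquiv.refl F F).prodCongr k.1).trans S),
      fun x y => by
        simp only [LinearEquiv.trans_apply]
        rw [splitEquiv_form hf.1]
        refine Eq.trans ?_ ((splitEquiv_form hf.1 v hv (S.symm x) (S.symm y)).symm.trans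
          (by change f (S _) (S _) = _; simp))
        rw [sumForm_apply, sumForm_apply, ← k.2 (S.symm x).2]
        rfl⟩
    have hav : a.1 v = v := by
      change S (((LinearEquiv.refl F F).prodCongr k.1) (S.symm v)) = v
      rw [hSv, hS]
      simp
    refine ⟨⟨a, hav⟩, Subtype.ext (LinearEquiv.ext fun w => Subtype.ext ?_)⟩
    rw [hφ]
    change S (((LinearEquiv.refl F F).prodCongr k.1) (S.symm w)) = _
    rw [hS', hS]
    simp

lemma card_orthogonalGroupOf [Finite F] (hF : ringChar F ≠ 2) [FiniteDimensional F V]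
    {f : LinearMap.BilinForm F V} (hf : IsOrthogonalForm f) (v : V) (hv : f v v ≠ 0) :
    Nat.card (orthogonalGroupOf f) = valueCount f (f v v) *
      Nat.card (orthogonalGroupOf (f.restrict (LinearMap.ker (f v)))) := by
  rw [← card_stabilizer hf v hv, valueCount]
  have h : Nat.card {u // f u u = f v v} =
      Nat.card (MulAction.orbit (orthogonalGroupOf f) v) :=
    Nat.card_congr (Equiv.subtypeEquivRight fun u => (mem_orbit_iff hF hf v hv u).symm)
  rw [h, ← Nat.card_prod]
  exact Nat.card_congr
    (MulAction.orbitProdStabilizerEquivGroup (orthogonalGroupOf f) v).symm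

lemma card_orthogonalGroupOf_of_finrank_eq_zero [FiniteDimensional F V]
    (f : LinearMap.BilinForm F V) (h : Module.finrank F V = 0) :
    Nat.card (orthogonalGroupOf f) = 1 := by
  have := Module.finrank_zero_iff.1 h
  exact Nat.card_eq_one_iff_unique.2 ⟨⟨fun a b =>
    Subtype.ext (LinearEquiv.ext fun x => Subsingleton.elim _ _)⟩, ⟨1⟩⟩

/-- Carries the models, built on spaces of their own, to a prescribed space. -/
lemma exists_formEquiv [FiniteDimensional F V] [FiniteDimensional F W]
    (f : LinearMap.BilinForm F V) (h : Module.finrank F V = Module.finrank F W) :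
    ∃ g : LinearMap.BilinForm F W, FormEquiv f g := by
  let e := LinearEquiv.ofFinrankEq V W h
  exact ⟨f.compl₁₂ (e.symm : W →ₗ[F] V) (e.symm : W →ₗ[F] V), e, fun u v => by simp⟩

end Group

/-! ### Orders of the groups -/

section Order

variable {F : Type w} [Field F] [Finite F]

/-- The complement of a vector of value 1 has odd dimension, where the order `A` is the same for all
forms. -/
lemma card_plus_succ (hF : ringChar F ≠ 2) {m : ℕ} {A : ℤ}
    (hodd : ∀ {V : Type u} [AddCommGroup V] [Module F V] [FiniteDimensional F V]
      {f : LinearMap.BilinForm F V}, IsOrthogonalForm f → Module.finrank F V = 2 * m + 1 →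
      (Nat.card (orthogonalGroupOf f) : ℤ) = A)
    {V : Type u} [AddCommGroup V] [Module F V] [FiniteDimensional F V]
    {f : LinearMap.BilinForm F V} (hf : IsOrthogonalForm f)
    (hV : Module.finrank F V = 2 * (m + 1)) (h : HasTotallyIsotropic f (m + 1)) :
    (Nat.card (orthogonalGroupOf f) : ℤ) = Nat.card F ^ m * (Nat.card F ^ (m + 1) - 1) * A := by
  obtain ⟨v, hv⟩ := exists_self_eq hF hf (by omega) 1
  have hv0 : f v v ≠ 0 := by simp [hv]
  have hq : (Nat.card F : ℤ) ≠ 0 := by exact_mod_cast Nat.card_pos.ne'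
  have hr := finrank_ker_add_one f v hv0
  rw [card_orthogonalGroupOf hF hf v hv0, Nat.cast_mul,
    hodd (exists_split hf v hv0).1 (by omega), hv]
  refine mul_left_cancel₀ hq ?_
  linear_combination A * valueCount_plus hF hf hV h one_ne_zero

lemma card_minus_succ (hF : ringChar F ≠ 2) {m : ℕ} {A : ℤ}
    (hodd : ∀ {V : Type u} [AddCommGroup V] [Module F V] [FiniteDimensional F V]
      {f : LinearMap.BilinForm F V}, IsOrthogonalForm f → Module.finrank F V = 2 * m + 1 →
      (Nat.card (orthogonalGroupOf f) : ℤ) = A)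
    {V : Type u} [AddCommGroup V] [Module F V] [FiniteDimensional F V]
    {f : LinearMap.BilinForm F V} (hf : IsOrthogonalForm f)
    (hV : Module.finrank F V = 2 * (m + 1)) (h : ¬ HasTotallyIsotropic f (m + 1)) :
    (Nat.card (orthogonalGroupOf f) : ℤ) = Nat.card F ^ m * (Nat.card F ^ (m + 1) + 1) * A := by
  obtain ⟨v, hv⟩ := exists_self_eq hF hf (by omega) 1
  have hv0 : f v v ≠ 0 := by simp [hv]
  have hq : (Nat.card F : ℤ) ≠ 0 := by exact_mod_cast Nat.card_pos.ne'
  have hr := finrank_ker_add_one f v hv0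
  rw [card_orthogonalGroupOf hF hf v hv0, Nat.cast_mul,
    hodd (exists_split hf v hv0).1 (by omega), hv]
  refine mul_left_cancel₀ hq ?_
  linear_combination A * valueCount_minus hF hf (show 1 ≤ m + 1 by omega) hV h

/-- Scaling by `(-1)^m * d` keeps the group and makes the discriminant `(-1)^m` modulo squares. The
complement of a vector of value 1 then has that same discriminant, so it is of plus type. -/
lemma card_odd_of_plus (hF : ringChar F ≠ 2) {m : ℕ} {A : ℤ}
    (hplus : ∀ {V : Type u} [AddCommGroup V] [Module F V] [FiniteDimensional F V]
      {f : LinearMap.BilinForm F V}, IsOrthogonalForm f → Module.finrank F V = 2 * m →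
      HasTotallyIsotropic f m → (Nat.card (orthogonalGroupOf f) : ℤ) = A)
    {V : Type u} [AddCommGroup V] [Module F V] [FiniteDimensional F V]
    {f : LinearMap.BilinForm F V} (hf : IsOrthogonalForm f)
    (hV : Module.finrank F V = 2 * m + 1) :
    (Nat.card (orthogonalGroupOf f) : ℤ) = Nat.card F ^ m * (Nat.card F ^ m + 1) * A := by
  obtain ⟨d, hd⟩ := exists_hasGramDet f
  have hc : (-1) ^ m * d ≠ 0 := mul_ne_zero (by simp) (hd.ne_zero hf)
  rw [← orthogonalGroupOf_smul f hc]
  have hg := hf.smul hc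
  have hgd := hd.smul ((-1) ^ m * d)
  have hs : IsSquare ((-1) ^ m * (((-1) ^ m * d) ^ Module.finrank F V * d)) :=
    ⟨((-1) ^ m * d) ^ (m + 1), by rw [hV]; ring⟩
  generalize ((-1) ^ m * d) • f = g at hg hgd
  have hN := valueCount_odd hF hg hgd hV hs
  -- The vector of value 1 comes from the count, since `exists_self_eq` does not cover dimension 1.
  have hpos : valueCount g 1 ≠ 0 := by
    have : (0 : ℤ) < Nat.card F := by exact_mod_cast Nat.card_pos
    have h : (valueCount g 1 : ℤ) ≠ 0 := by rw [hN]; positivity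
    exact_mod_cast h
  obtain ⟨⟨v, hv⟩⟩ := (Nat.card_ne_zero.1 hpos).1
  have hv0 : g v v ≠ 0 := by simp [hv]
  have hr := finrank_ker_add_one g v hv0
  obtain ⟨ho, he⟩ := exists_split hg v hv0
  obtain ⟨e, hge⟩ := exists_hasGramDet (g.restrict (LinearMap.ker (g v)))
  have hdet := ((lineForm_hasGramDet _).sum hge).map he
  rw [hv, one_mul] at hdet
  have hiso : HasTotallyIsotropic (g.restrict (LinearMap.ker (g v))) m := by
    rw [hasTotallyIsotropic_iff hF ho hge (by omega)]
    obtain ⟨a, rfl⟩ := hgd.exists_sq hdet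
    rw [mul_left_comm]
    exact (IsSquare.sq a).mul hs
  rw [card_orthogonalGroupOf hF hg v hv0, Nat.cast_mul, hv, hN, hplus ho (by omega) hiso]

theorem card_odd (hF : ringChar F ≠ 2) (m : ℕ) :
    ∀ {V : Type u} [AddCommGroup V] [Module F V] [FiniteDimensional F V]
      {f : LinearMap.BilinForm F V}, IsOrthogonalForm f → Module.finrank F V = 2 * m + 1 →
      (Nat.card (orthogonalGroupOf f) : ℤ) = 2 * Nat.card F ^ (m ^ 2) *
        ∏ i ∈ Finset.range m, ((Nat.card F : ℤ) ^ (2 * (i + 1)) - 1) := by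
  induction m with
  | zero =>
    intro V _ _ _ f hf hV
    -- The recursion starts from the trivial group in dimension 0.
    rw [card_odd_of_plus hF (A := 1) ?_ hf hV]
    · simp
    · intro V _ _ _ f hf hV _
      exact_mod_cast card_orthogonalGroupOf_of_finrank_eq_zero f hV
  | succ m ih =>
    intro V _ _ _ f hf hV
    rw [card_odd_of_plus hF (card_plus_succ hF ih) hf hV, Finset.prod_range_succ]
    ring

lemma prod_Icc_eq_prod_range (q : ℤ) (m : ℕ) :
    ∏ i ∈ Finset.Icc 1 m, (q ^ (2 * (m + 1) - 2 * i) - 1) =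
      ∏ i ∈ Finset.range m, (q ^ (2 * (i + 1)) - 1) := by
  refine Finset.prod_nbij' (fun i => m - i) (fun i => m - i) ?_ ?_ ?_ ?_ ?_
  · intro i hi; simp at hi ⊢; omega
  · intro i hi; simp at hi ⊢; omega
  · intro i hi; simp at hi ⊢; omega
  · intro i hi; simp at hi ⊢; omega
  · intro i hi
    simp at hi
    congr 2
    omega

variable {V : Type u} [AddCommGroup V] [Module F V] [FiniteDimensional F V]

theorem card_plus (hF : ringChar F ≠ 2) {m : ℕ} (hm : 1 ≤ m) {f : LinearMap.BilinForm F V}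
    (hf : IsOrthogonalForm f) (hV : Module.finrank F V = 2 * m) (h : HasTotallyIsotropic f m) :
    (Nat.card (orthogonalGroupOf f) : ℤ) =
      2 * ((Nat.card F : ℤ) ^ m - 1) * (Nat.card F : ℤ) ^ (m * (m - 1)) *
        ∏ i ∈ Finset.Icc 1 (m - 1), ((Nat.card F : ℤ) ^ (2 * m - 2 * i) - 1) := by
  obtain ⟨m, rfl⟩ : ∃ k, m = k + 1 := ⟨m - 1, by omega⟩
  rw [card_plus_succ hF (card_odd hF m) hf hV h, Nat.add_sub_cancel, prod_Icc_eq_prod_range]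
  ring

theorem card_minus (hF : ringChar F ≠ 2) {m : ℕ} (hm : 1 ≤ m) {f : LinearMap.BilinForm F V}
    (hf : IsOrthogonalForm f) (hV : Module.finrank F V = 2 * m) (h : ¬ HasTotallyIsotropic f m) :
    (Nat.card (orthogonalGroupOf f) : ℤ) =
      2 * ((Nat.card F : ℤ) ^ m + 1) * (Nat.card F : ℤ) ^ (m * (m - 1)) *
        ∏ i ∈ Finset.Icc 1 (m - 1), ((Nat.card F : ℤ) ^ (2 * m - 2 * i) - 1) := by
  obtain ⟨m, rfl⟩ : ∃ k, m = k + 1 := ⟨m - 1, by omega⟩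
  rw [card_minus_succ hF (card_odd hF m) hf hV h, Nat.add_sub_cancel, prod_Icc_eq_prod_range]
  ring

/-- Cancelling the common nonzero factors would leave `q ^ m - 1 = q ^ m + 1`. -/
lemma card_plus_ne_card_minus (m : ℕ) :
    2 * ((Nat.card F : ℤ) ^ m - 1) * (Nat.card F : ℤ) ^ (m * (m - 1)) *
        ∏ i ∈ Finset.Icc 1 (m - 1), ((Nat.card F : ℤ) ^ (2 * m - 2 * i) - 1) ≠
      2 * ((Nat.card F : ℤ) ^ m + 1) * (Nat.card F : ℤ) ^ (m * (m - 1)) *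
        ∏ i ∈ Finset.Icc 1 (m - 1), ((Nat.card F : ℤ) ^ (2 * m - 2 * i) - 1) := by
  have hq : (1 : ℤ) < Nat.card F := by exact_mod_cast Finite.one_lt_card
  have hP : ∏ i ∈ Finset.Icc 1 (m - 1), ((Nat.card F : ℤ) ^ (2 * m - 2 * i) - 1) ≠ 0 := by
    refine Finset.prod_ne_zero_iff.2 fun i hi => sub_ne_zero.2 (one_lt_pow₀ hq ?_).ne'
    rw [Finset.mem_Icc] at hi
    omega
  intro h
  have h' := mul_right_cancel₀ (pow_ne_zero _ (by positivity)) (mul_right_cancel₀ hP h)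
  linarith

end Order

/-! ### Existence of both types and uniqueness of the groups -/

section Types

variable {F : Type w} [Field F] [Finite F] {V : Type u} [AddCommGroup V] [Module F V]
  [FiniteDimensional F V] {V' : Type v} [AddCommGroup V'] [Module F V'] [FiniteDimensional F V']

lemma formEquiv_of_hasTotallyIsotropic_iff (hF : ringChar F ≠ 2) {m : ℕ}
    (hV : Module.finrank F V = 2 * m) (hV' : Module.finrank F V' = 2 * m)
    {f : LinearMap.BilinForm F V} {f' : LinearMap.BilinForm F V'} (hf : IsOrthogonalForm f)
    (hf' : IsOrthogonalForm f') (h : HasTotallyIsotropic f m ↔ HasTotallyIsotropic f' m) :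
    FormEquiv f f' := by
  obtain ⟨d, hd⟩ := exists_hasGramDet f
  obtain ⟨d', hd'⟩ := exists_hasGramDet f'
  refine formEquiv_of_isSquare hF _ hV hV' hf hf' hd hd' ?_
  rw [hasTotallyIsotropic_iff hF hf hd hV, hasTotallyIsotropic_iff hF hf' hd' hV'] at h
  have hs : IsSquare (((-1) ^ m * d) * ((-1) ^ m * d')) := by
    by_cases h1 : IsSquare ((-1) ^ m * d)
    · exact h1.mul (h.1 h1)
    · exact isSquare_mul_of_not h1 (mt h.2 h1)
  have h1 : ((-1 : F) ^ m) ^ 2 = 1 := by rw [← pow_mul, mul_comm, pow_mul]; simp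
  convert hs using 1
  linear_combination -d * d' * h1

/-- In odd dimension any two orthogonal groups are isomorphic, the forms being similar. -/
lemma nonempty_mulEquiv_of_odd (hF : ringChar F ≠ 2) {n : ℕ} (hn : Odd n)
    (hV : Module.finrank F V = n) (hV' : Module.finrank F V' = n)
    {f : LinearMap.BilinForm F V} {f' : LinearMap.BilinForm F V'} (hf : IsOrthogonalForm f)
    (hf' : IsOrthogonalForm f') : Nonempty (orthogonalGroupOf f ≃* orthogonalGroupOf f') := by
  obtain ⟨d, hd⟩ := exists_hasGramDet f
  obtain ⟨d', hd'⟩ := exists_hasGramDet f'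
  have hc : d * d' ≠ 0 := mul_ne_zero (hd.ne_zero hf) (hd'.ne_zero hf')
  rw [← orthogonalGroupOf_smul f hc]
  obtain ⟨m, rfl⟩ := hn
  refine (formEquiv_of_isSquare hF _ hV hV' (hf.smul hc) hf' (hd.smul _) hd' ?_).nonempty_mulEquiv
  -- With `c = d * d'` the scaled discriminant times `d'` is `c ^ (2m + 1) * d * d' = c ^ (2m + 2)`.
  exact ⟨(d * d') ^ (m + 1), by rw [hV]; ring⟩

lemma exists_isOrthogonalForm_of_odd (hF : ringChar F ≠ 2) {n : ℕ} (hn : Odd n)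
    (hV : Module.finrank F V = n) : ∃ f : LinearMap.BilinForm F V, IsOrthogonalForm f := by
  obtain ⟨m, rfl⟩ := hn
  obtain ⟨U, _, _, _, k, hU, hk, -⟩ := exists_hypForm_sum hF
    (isOrthogonalForm_lineForm (one_ne_zero (α := F))) (lineForm_hasGramDet 1) m
  obtain ⟨f, hf⟩ := exists_formEquiv (W := V) k (by rw [hU, hV, Module.finrank_self])
  exact ⟨f, hk.of_formEquiv hf⟩

lemma exists_plus (hF : ringChar F ≠ 2) {m : ℕ} (hV : Module.finrank F V = 2 * m) :
    ∃ f : LinearMap.BilinForm F V, IsOrthogonalForm f ∧ HasTotallyIsotropic f m := by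
  obtain ⟨U, _, _, _, k, hU, hk, -, hiso, -⟩ := exists_hypForm_sum hF
    (zero_isOrthogonalForm (F := F)) (hasGramDet_one_of_finrank_eq_zero _ (by simp)) m
  obtain ⟨f, hf⟩ := exists_formEquiv (W := V) k (by simp [hU, hV])
  exact ⟨f, hk.of_formEquiv hf, hiso.of_formEquiv hf⟩

lemma exists_minus (hF : ringChar F ≠ 2) {m : ℕ} (hm : 1 ≤ m) (hV : Module.finrank F V = 2 * m) :
    ∃ f : LinearMap.BilinForm F V, IsOrthogonalForm f ∧ ¬ HasTotallyIsotropic f m := by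
  obtain ⟨ε, hε⟩ := FiniteField.exists_nonsquare hF
  have hε0 : ε ≠ 0 := by rintro rfl; exact hε IsSquare.zero
  obtain ⟨m, rfl⟩ : ∃ k, m = k + 1 := ⟨m - 1, by omega⟩
  obtain ⟨U, _, _, _, k, hU, hk, hkd, -⟩ := exists_hypForm_sum hF
    ((isOrthogonalForm_lineForm one_ne_zero).sum (isOrthogonalForm_lineForm (neg_ne_zero.2 hε0)))
    ((lineForm_hasGramDet _).sum (lineForm_hasGramDet _)) m
  obtain ⟨f, hf⟩ := exists_formEquiv (W := V) k (by rw [hU, hV]; simp; ring)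
  refine ⟨f, hk.of_formEquiv hf, ?_⟩
  rw [hasTotallyIsotropic_iff hF (hk.of_formEquiv hf) (hkd.map hf) hV]
  have h1 : ((-1 : F) ^ m) ^ 2 = 1 := by rw [← pow_mul, mul_comm, pow_mul]; simp
  -- The signs of the hyperbolic planes and of `-ε` cancel, leaving exactly the nonsquare `ε`.
  convert hε using 2
  linear_combination ε * h1

end Types

theorem mainTheorem2 {F V V' : Type*} [Field F] [Finite F] (hF : ringChar F ≠ 2)
    [AddCommGroup V] [Module F V] [FiniteDimensional F V]
    [AddCommGroup V'] [Module F V'] [FiniteDimensional F V']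
    (n : ℕ) (hV : Module.finrank F V = n) (hV' : Module.finrank F V' = n) :
    -- `n` odd: exactly one orthogonal group up to isomorphism
    (Odd n →
      ∃ f : LinearMap.BilinForm F V, IsOrthogonalForm f ∧
        ∀ f' : LinearMap.BilinForm F V', IsOrthogonalForm f' →
          Nonempty (orthogonalGroupOf f' ≃* orthogonalGroupOf f)) ∧
    -- `n = 2m` even and positive: exactly two orthogonal groups up to isomorphism
    (∀ m : ℕ, 1 ≤ m → n = 2 * m →
      (∃ fp fm : LinearMap.BilinForm F V,
        (IsOrthogonalForm fp ∧ HasTotallyIsotropic fp m) ∧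
        (IsOrthogonalForm fm ∧ ¬ HasTotallyIsotropic fm m) ∧
        IsEmpty (orthogonalGroupOf fp ≃* orthogonalGroupOf fm) ∧
        ∀ f' : LinearMap.BilinForm F V', IsOrthogonalForm f' →
          (HasTotallyIsotropic f' m → Nonempty (orthogonalGroupOf f' ≃* orthogonalGroupOf fp)) ∧
          (¬ HasTotallyIsotropic f' m →
            Nonempty (orthogonalGroupOf f' ≃* orthogonalGroupOf fm))) ∧
      -- the orders of the two groups
      (∀ f : LinearMap.BilinForm F V, IsOrthogonalForm f →
        (HasTotallyIsotropic f m →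
          (Nat.card (orthogonalGroupOf f) : ℤ) =
            2 * ((Nat.card F : ℤ) ^ m - 1) * (Nat.card F : ℤ) ^ (m * (m - 1)) *
              ∏ i ∈ Finset.Icc 1 (m - 1), ((Nat.card F : ℤ) ^ (2 * m - 2 * i) - 1)) ∧
        (¬ HasTotallyIsotropic f m →
          (Nat.card (orthogonalGroupOf f) : ℤ) =
            2 * ((Nat.card F : ℤ) ^ m + 1) * (Nat.card F : ℤ) ^ (m * (m - 1)) *
              ∏ i ∈ Finset.Icc 1 (m - 1), ((Nat.card F : ℤ) ^ (2 * m - 2 * i) - 1)))) := by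

  refine ⟨fun hn => ?_, fun m hm hnm => ?_⟩
  · obtain ⟨f, hf⟩ := exists_isOrthogonalForm_of_odd hF hn hV
    exact ⟨f, hf, fun f' hf' => nonempty_mulEquiv_of_odd hF hn hV' hV hf' hf⟩
  · subst hnm
    refine ⟨?_, fun f hf => ⟨card_plus hF hm hf hV, card_minus hF hm hf hV⟩⟩
    obtain ⟨fp, hfp, hp⟩ := exists_plus hF hV
    obtain ⟨fm, hfm, hn⟩ := exists_minus hF hm hV
    refine ⟨fp, fm, ⟨hfp, hp⟩, ⟨hfm, hn⟩, ⟨fun e => ?_⟩, fun f' hf' => ⟨fun h => ?_, fun h => ?_⟩⟩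
    · apply card_plus_ne_card_minus (F := F) m
      rw [← card_plus hF hm hfp hV hp, ← card_minus hF hm hfm hV hn, Nat.card_congr e.toEquiv]
    · exact (formEquiv_of_hasTotallyIsotropic_iff hF hV' hV hf' hfp
        (iff_of_true h hp)).nonempty_mulEquiv
    · exact (formEquiv_of_hasTotallyIsotropic_iff hF hV' hV hf' hfm
        (iff_of_false h hn)).nonempty_mulEquiv
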